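/- All graphs are finite and simple. For integers $t,k\ge 3$, let $\mathcal{T}_k$ denote the family of all trees on $k$ vertices, and write $G\rightarrow (K_t,\mathcal{T}_k)$ if every coloring of the edges of the graph $G$ with the two colors red and blue contains a red copy of the complete graph $K_t$ or a blue copy of some tree in $\mathcal{T}_k$. A graph $G$ is called $(K_t,\mathcal{T}_k)$-co-critical if $G$ is not complete, $G\nrightarrow (K_t,\mathcal{T}_k)$, and $G+e\rightarrow (K_t,\mathcal{T}_k)$ for every edge $e$ of the complement $\overline{G}$. Let $e(G)$ denote the number of edges of $G$. Theorem. Let $t,k\in\mathbb{N}$ with $t\ge 4$ and $k\ge\max\{6,t\}$. There exists a constant $\ell(t,k)$, depending only on $t$ and $k$, such that for all $n\in\mathbb{N}$ with $n\ge (t-1)(k-1)+1$, every $(K_t,\mathcal{T}_k)$-co-critical graph $G$ on $n$ vertices satisfies $$e(G)\ \ge\ \left(\frac{4t-9}{2}+\frac12\left\lceil\frac{k}{2}\right\rceil\right)n-\ell(t,k).$$ -/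

import Mathlib

/-- The family `𝒯_k` of all trees on `k` vertices (on the vertex set `Fin k`). -/
def treeFamily (k : ℕ) : Set (SimpleGraph (Fin k)) :=
  {T | T.IsTree}

/-- A two-coloring of the edges of `G` is an edge labeling by `Bool`; an edge labeled `true` is
red. This is the spanning subgraph `G_r` formed by the red edges. -/
def redGraph {V : Type*} {G : SimpleGraph V} (τ : G.EdgeLabeling Bool) : SimpleGraph V :=
  τ.labelGraph true

/-- The spanning subgraph `G_b` formed by the blue edges, those labeled `false`. -/
def blueGraph {V : Type*} {G : SimpleGraph V} (τ : G.EdgeLabeling Bool) : SimpleGraph V :=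
  τ.labelGraph false

/-- `G → (K_t, 𝒯_k)`: for every red/blue coloring of the edges of `G` there is a red `K_t` or a
blue tree on `k` vertices. -/
def ArrowsCliqueTree {V : Type*} (G : SimpleGraph V) (t k : ℕ) : Prop :=
  ∀ τ : G.EdgeLabeling Bool,
    (⊤ : SimpleGraph (Fin t)).IsContained (redGraph τ) ∨
      ∃ T ∈ treeFamily k, T.IsContained (blueGraph τ)

/-- `G` is `(K_t, 𝒯_k)`-co-critical: `G` is not complete, `G ↛ (K_t, 𝒯_k)`, and
`G + uv → (K_t, 𝒯_k)` for every edge `uv` of the complement of `G`. -/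
structure IsCoCritical {V : Type*} (G : SimpleGraph V) (t k : ℕ) : Prop where
  not_complete : G ≠ ⊤
  not_arrows : ¬ ArrowsCliqueTree G t k
  arrows_add_edge : ∀ u v : V, Gᶜ.Adj u v → ArrowsCliqueTree (G ⊔ SimpleGraph.edge u v) t k

-- Take a coloring of `G` with no red `K_t` and no blue tree on `k` vertices. Its blue components
-- have fewer than `k` vertices; recoloring all edges inside them blue keeps the coloring good. So
-- the coloring becomes a vertex partition `c` whose cross edges (`crossGraph`, the red graph) are
-- `K_t`-free. Co-criticality then makes each fiber a clique of `G` and gives every non-adjacent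
-- pair a red `K_{t-2}` in its common red neighborhood and fiber sizes adding up to at least `k`.
--
-- The degree sum splits into a blue and a red part. Blue: vertices in fibers smaller than `k/2`
-- number at most `t * k`, so nearly every vertex has at least `⌈k/2⌉ - 1` neighbors in its fiber.
-- Red: put `s = 2 * (t - 2)`; it suffices to find `s * n - O(1)` red edges. First, Hajnal's lemma
-- shows that all but boundedly many vertices have red degree at least `s`
-- (`IsCoCritical.exists_degree_ge`). Second, percolation from a bounded set, with the sunflower
-- lemma as stopping argument, doubles the naive count `s * n / 2`
-- (`exists_percolation_of_degree_ge`). Adding both parts and halving gives the bound.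

universe u

/-! ### Trees inside connected graphs -/

namespace SimpleGraph

/-- A finite connected graph on at least `k` vertices contains a tree on exactly `k` vertices. -/
theorem Connected.exists_isTree_isContained {W : Type*} [Finite W] {H : SimpleGraph W}
    (hH : H.Connected) {k : ℕ} (hk : 1 ≤ k) (hkW : k ≤ Nat.card W) :
    ∃ T : SimpleGraph (Fin k), T.IsTree ∧ T.IsContained H := by
  obtain ⟨m, hm⟩ : ∃ m, Nat.card W = k + m := ⟨_, (Nat.add_sub_cancel' hkW).symm⟩
  clear hkW
  induction m generalizing W with
  | zero =>
    obtain ⟨T, hT, hTree⟩ := hH.exists_isTree_le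
    have e : W ≃ Fin k := Finite.equivFinOfCardEq (by simpa using hm)
    refine ⟨T.map e.toEmbedding, ?_, ?_⟩
    · exact ((Iso.map e T).isTree_iff).1 hTree
    · exact ⟨(Copy.ofLE T H hT).comp (Iso.map e T).symm.toCopy⟩
  | succ m ih =>
    have : Nontrivial W := (Finite.one_lt_card_iff_nontrivial).1 (by omega)
    obtain ⟨v, hv⟩ := hH.exists_connected_induce_compl_singleton_of_finite_nontrivial
    have hcard : Nat.card ({v}ᶜ : Set W) = k + m := by
      have := Set.ncard_compl ({v} : Set W)
      rw [Set.ncard_singleton] at this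
      rw [Nat.card_coe_set_eq]
      omega
    obtain ⟨T, hT, hTH⟩ := ih hv hcard
    exact ⟨T, hT, hTH.trans ⟨(Embedding.induce _).toCopy⟩⟩

end SimpleGraph

/-! ### Colorings as vertex partitions -/

section Partition

variable {V ι : Type*} {G : SimpleGraph V} {t k : ℕ}

/-- The edges of `G` joining different fibers of `c`. -/
def crossGraph (G : SimpleGraph V) (c : V → ι) : SimpleGraph V where
  Adj u v := G.Adj u v ∧ c u ≠ c v
  symm := ⟨fun _ _ h => ⟨h.1.symm, h.2.symm⟩⟩
  loopless := ⟨fun _ h => h.2 rfl⟩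

@[simp]
theorem crossGraph_adj {c : V → ι} {u v : V} :
    (crossGraph G c).Adj u v ↔ G.Adj u v ∧ c u ≠ c v := Iff.rfl

/-- The fiber of `c` through `v`. -/
noncomputable def fiber [Fintype V] (c : V → ι) (v : V) : Finset V :=
  open Classical in Finset.univ.filter fun w => c w = c v

@[simp]
theorem mem_fiber [Fintype V] {c : V → ι} {v w : V} : w ∈ fiber c v ↔ c w = c v := by
  simp [fiber]

/-- A partition of the vertices into fibers of size less than `k` such that the edges of `G`
between different fibers form a `K_t`-free graph. -/
structure IsGoodPartition [Fintype V] (G : SimpleGraph V) (t k : ℕ) (c : V → ι) : Prop where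
  card_fiber_lt : ∀ v, (fiber c v).card < k
  cliqueFree : (crossGraph G c).CliqueFree t

/-- Color an edge red exactly when it crosses fibers. A blue tree is connected, hence confined to
one fiber, which is too small. -/
theorem IsGoodPartition.not_arrows [Fintype V] {c : V → ι} (hc : IsGoodPartition G t k c)
    (hk : 1 ≤ k) : ¬ ArrowsCliqueTree G t k := by
  classical
  intro h
  let τ : G.EdgeLabeling Bool := fun e => decide (∃ u v, (e : Sym2 V) = s(u, v) ∧ c u ≠ c v)
  have hred : redGraph τ ≤ crossGraph G c := by
    intro u v huv
    obtain ⟨h1, h2⟩ := (SimpleGraph.EdgeLabeling.labelGraph_adj u v).1 huv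
    refine ⟨h1, ?_⟩
    obtain ⟨a, b, hab, hne⟩ := of_decide_eq_true h2
    rcases Sym2.eq_iff.1 hab with ⟨rfl, rfl⟩ | ⟨rfl, rfl⟩
    · exact hne
    · exact hne.symm
  have hblue : ∀ u v, (blueGraph τ).Adj u v → c u = c v := by
    intro u v huv
    obtain ⟨h1, h2⟩ := (SimpleGraph.EdgeLabeling.labelGraph_adj u v).1 huv
    by_contra hne
    exact of_decide_eq_false h2 ⟨u, v, rfl, hne⟩
  rcases h τ with h | ⟨T, hT, ⟨f⟩⟩
  · exact (h.trans (SimpleGraph.IsContained.of_le hred)).not_cliqueFree hc.cliqueFree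
  · have hconst : ∀ i j, c (f i) = c (f j) := by
      intro i j
      obtain ⟨w⟩ := hT.connected.preconnected i j
      induction w with
      | nil => rfl
      | cons h _ ih => exact (hblue _ _ (f.toHom.map_adj h)).trans ih
    have h0 := hc.card_fiber_lt (f ⟨0, hk⟩)
    have : (Finset.univ.map ⟨f, f.injective⟩).card ≤ (fiber c (f ⟨0, hk⟩)).card := by
      apply Finset.card_le_card
      intro x hx
      obtain ⟨i, -, rfl⟩ := Finset.mem_map.1 hx
      exact mem_fiber.2 (hconst _ _)
    simp at this
    omega

/-- The fibers are the blue components of a good coloring; a component with `k` vertices would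
contain a blue tree, and every cross edge is red. -/
theorem exists_isGoodPartition {V : Type u} {G : SimpleGraph V} [Fintype V] (hk : 1 ≤ k) (h : ¬ ArrowsCliqueTree G t k) :
    ∃ (ι : Type u) (c : V → ι), IsGoodPartition G t k c := by
  classical
  obtain ⟨τ, hτ⟩ := not_forall.1 h
  obtain ⟨h1, h2⟩ := not_or.1 hτ
  refine ⟨_, (blueGraph τ).connectedComponentMk, ?_, ?_⟩
  · intro v
    by_contra! hv
    set C := (blueGraph τ).connectedComponentMk v
    have hcard : k ≤ Nat.card C := by
      refine hv.trans (le_of_eq ?_)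
      rw [← Set.ncard_coe_finset]
      change _ = Nat.card C.supp
      rw [Nat.card_coe_set_eq]
      congr 1
      ext w
      simp [C, SimpleGraph.ConnectedComponent.mem_supp_iff]
    obtain ⟨T, hT, hTC⟩ := C.connected_toSimpleGraph.exists_isTree_isContained hk hcard
    exact h2 ⟨T, hT, hTC.trans ⟨(SimpleGraph.Embedding.induce _).toCopy⟩⟩
  · by_contra hcon
    apply h1
    refine ((SimpleGraph.not_cliqueFree_iff_top_isContained t).1 hcon).trans
      (SimpleGraph.IsContained.of_le ?_)
    rintro u v ⟨huv, hne⟩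
    refine (SimpleGraph.EdgeLabeling.labelGraph_adj u v).2 ⟨huv, ?_⟩
    by_contra hb
    apply hne
    refine SimpleGraph.ConnectedComponent.sound (SimpleGraph.Adj.reachable ?_)
    exact (SimpleGraph.EdgeLabeling.labelGraph_adj u v).2 ⟨huv, by simpa using hb⟩

end Partition

/-! ### Local consequences of co-criticality -/

section CoCritical

variable {V ι : Type*} [Fintype V] {G : SimpleGraph V} {t k : ℕ} {c : V → ι}

theorem IsCoCritical.not_isGoodPartition_sup_edge {κ : Type*} (hG : IsCoCritical G t k)
    (hk : 1 ≤ k) {u v : V} (hne : u ≠ v) (huv : ¬ G.Adj u v) (c : V → κ) :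
    ¬ IsGoodPartition (G ⊔ SimpleGraph.edge u v) t k c := fun h =>
  h.not_arrows hk (hG.arrows_add_edge u v ((SimpleGraph.compl_adj G u v).2 ⟨hne, huv⟩))

theorem IsCoCritical.adj_of_fiber (hG : IsCoCritical G t k) (hk : 1 ≤ k)
    (hc : IsGoodPartition G t k c) {u v : V} (hne : u ≠ v) (h : c u = c v) : G.Adj u v := by
  by_contra huv
  refine hG.not_isGoodPartition_sup_edge hk hne huv c ⟨hc.card_fiber_lt, ?_⟩
  refine hc.cliqueFree.anti ?_
  rintro a b ⟨hab, hcab⟩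
  refine ⟨?_, hcab⟩
  rcases hab with hab | hab
  · exact hab
  · rw [SimpleGraph.edge_adj] at hab
    rcases hab.1 with ⟨rfl, rfl⟩ | ⟨rfl, rfl⟩
    · exact absurd h hcab
    · exact absurd h.symm hcab

/-- Keeping the same partition after adding `uv` must create a red `K_t`; it uses `uv`, and its
other vertices form the clique. -/
theorem IsCoCritical.exists_clique (hG : IsCoCritical G t k) (hk : 1 ≤ k)
    (hc : IsGoodPartition G t k c) {u v : V} (hne : u ≠ v) (huv : ¬ G.Adj u v) :
    ∃ Q : Finset V, (crossGraph G c).IsNClique (t - 2) Q ∧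
      ∀ q ∈ Q, (crossGraph G c).Adj u q ∧ (crossGraph G c).Adj v q := by
  classical
  have hnot : ¬ (crossGraph (G ⊔ SimpleGraph.edge u v) c).CliqueFree t := fun h =>
    hG.not_isGoodPartition_sup_edge hk hne huv c ⟨hc.card_fiber_lt, h⟩
  unfold SimpleGraph.CliqueFree at hnot
  push Not at hnot
  obtain ⟨K, hK⟩ := hnot
  have key : ∀ a ∈ K, ∀ b ∈ K, a ≠ b → ¬ (a = u ∧ b = v) → ¬ (a = v ∧ b = u) →
      (crossGraph G c).Adj a b := by
    intro a ha b hb hab h1 h2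
    obtain ⟨h3, h4⟩ := hK.isClique ha hb hab
    refine ⟨?_, h4⟩
    rcases h3 with h3 | h3
    · exact h3
    · rw [SimpleGraph.edge_adj] at h3
      tauto
  have hmem : u ∈ K ∧ v ∈ K := by
    by_contra hcon
    refine hc.cliqueFree K ⟨fun a ha b hb hab => key a ha b hb hab ?_ ?_, hK.card_eq⟩
    · rintro ⟨rfl, rfl⟩; exact hcon ⟨ha, hb⟩
    · rintro ⟨rfl, rfl⟩; exact hcon ⟨hb, ha⟩
  refine ⟨(K.erase u).erase v, ⟨fun a ha b hb hab => ?_, ?_⟩, fun q hq => ?_⟩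
  · simp only [Finset.coe_erase, Set.mem_sdiff, Finset.mem_coe, Set.mem_singleton_iff] at ha hb
    exact key a ha.1.1 b hb.1.1 hab (by tauto) (by tauto)
  · rw [Finset.card_erase_of_mem (by simp [hmem.2, hne.symm]), Finset.card_erase_of_mem hmem.1,
      hK.card_eq]
    omega
  · simp only [Finset.mem_erase] at hq
    exact ⟨key u hmem.1 q hq.2.2 (Ne.symm hq.2.1) (by tauto) (by tauto),
      key v hmem.2 q hq.2.2 (Ne.symm hq.1) (by tauto) (by tauto)⟩

/-- Otherwise the two fibers could be merged, which absorbs the new edge and creates no red edge. -/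
theorem IsCoCritical.le_card_fiber_add_card_fiber (hG : IsCoCritical G t k) (hk : 1 ≤ k)
    (hc : IsGoodPartition G t k c) {u v : V} (hne : u ≠ v) (huv : ¬ G.Adj u v) :
    k ≤ (fiber c u).card + (fiber c v).card := by
  classical
  by_contra! hlt
  let c' : V → ι := fun w => if c w = c u then c v else c w
  refine hG.not_isGoodPartition_sup_edge hk hne huv c' ⟨fun w => ?_, hc.cliqueFree.anti ?_⟩
  · by_cases hw : c w = c u ∨ c w = c v
    · have hsub : fiber c' w ⊆ fiber c u ∪ fiber c v := by
        intro x hx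
        simp only [mem_fiber, Finset.mem_union, c'] at hx ⊢
        grind
      exact ((Finset.card_le_card hsub).trans (Finset.card_union_le _ _)).trans_lt hlt
    · have hsub : fiber c' w ⊆ fiber c w := by
        intro x hx
        simp only [mem_fiber, c'] at hx ⊢
        grind
      exact (Finset.card_le_card hsub).trans_lt (hc.card_fiber_lt w)
  · rintro a b ⟨hab, hne'⟩
    rcases hab with hab | hab
    · refine ⟨hab, fun h => hne' ?_⟩
      simp [c', h]
    · rw [SimpleGraph.edge_adj] at hab
      exfalso
      apply hne'
      rcases hab.1 with ⟨rfl, rfl⟩ | ⟨rfl, rfl⟩ <;> simp [c']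

/-- Were `x` red-adjacent to everything, add a missing edge `dv` and make `{x, d}` a fiber. A new
red `K_t` would contain `d` but not `x`, and swapping `d` for `x` would give an old one. -/
theorem IsCoCritical.exists_not_crossGraph_adj (hG : IsCoCritical G t k) (hk : 3 ≤ k)
    (hc : IsGoodPartition G t k c) (x : V) : ∃ y, y ≠ x ∧ ¬ (crossGraph G c).Adj x y := by
  classical
  by_contra! hx
  obtain ⟨d, v, hne, hdv⟩ : ∃ d v, d ≠ v ∧ ¬ G.Adj d v := by
    by_contra! h
    exact hG.not_complete (by ext a b; exact ⟨fun h' => h'.ne, fun h' => h a b h'⟩)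
  have hdx : d ≠ x := by rintro rfl; exact hdv (hx v hne.symm).1
  let c' : V → Option (Option ι) := fun w =>
    if w = x then none else if w = d then none else some (some (c w))
  refine hG.not_isGoodPartition_sup_edge (by omega) hne hdv c' ⟨fun w => ?_, fun K hK => ?_⟩
  · by_cases hw : w = x ∨ w = d
    · have hsub : fiber c' w ⊆ {x, d} := by
        intro y hy
        simp only [mem_fiber, c', Finset.mem_insert, Finset.mem_singleton] at hy ⊢
        grind
      exact ((Finset.card_le_card hsub).trans Finset.card_le_two).trans_lt (by omega)
    · have hsub : fiber c' w ⊆ fiber c w := by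
        intro y hy
        simp only [mem_fiber, c'] at hy ⊢
        grind
      exact (Finset.card_le_card hsub).trans_lt (hc.card_fiber_lt w)
  · have key : ∀ a ∈ K, ∀ b ∈ K, a ≠ b → a ≠ d → b ≠ d → (crossGraph G c).Adj a b := by
      intro a ha b hb hab had hbd
      obtain ⟨h3, h4⟩ := hK.isClique ha hb hab
      by_cases hax : a = x
      · subst hax; exact hx b hab.symm
      by_cases hbx : b = x
      · subst hbx; exact (hx a hab).symm
      refine ⟨?_, fun h => h4 (by simp [c', *])⟩
      rcases h3 with h3 | h3
      · exact h3
      · rw [SimpleGraph.edge_adj] at h3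
        tauto
    by_cases hd : d ∈ K
    · have hxK : x ∉ K := fun hxK => by
        have := (hK.isClique hd hxK hdx).2
        simp [c'] at this
      refine hc.cliqueFree (insert x (K.erase d)) ⟨?_, ?_⟩
      · intro a ha b hb hab
        simp only [Finset.coe_insert, Finset.coe_erase, Set.mem_insert_iff, Set.mem_sdiff,
          Finset.mem_coe, Set.mem_singleton_iff] at ha hb
        rcases ha with rfl | ha
        · exact hx b hab.symm
        rcases hb with rfl | hb
        · exact (hx a hab).symm
        exact key a ha.1 b hb.1 hab ha.2 hb.2
      · rw [Finset.card_insert_of_notMem (by simp [hxK]), Finset.card_erase_of_mem hd, hK.card_eq]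
        have := Finset.card_pos.2 ⟨d, hd⟩
        rw [hK.card_eq] at this
        omega
    · refine hc.cliqueFree K ⟨fun a ha b hb hab => key a ha b hb hab ?_ ?_, hK.card_eq⟩
      · rintro rfl; exact hd ha
      · rintro rfl; exact hd hb

end CoCritical

/-! ### Vertices of small red degree -/

section LowDegree

open Classical

variable {V ι : Type*} [Fintype V]

theorem SimpleGraph.CliqueFree.card_lt_of_isClique {V : Type*} {r : SimpleGraph V} {t : ℕ}
    (h : r.CliqueFree t) {S : Finset V} (hS : r.IsClique S) : S.card < t := by
  by_contra! hlt
  exact h.mono hlt S ⟨hS, rfl⟩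

/-- Hajnal's clique lemma: the intersection and the union of a nonempty family of maximum cliques
together have at least as many elements as two of the cliques. -/
theorem SimpleGraph.two_mul_le_card_inter_add_card_union {V : Type*} (r : SimpleGraph V) {m : ℕ}
    {N : Finset V} (hmax : ∀ S ⊆ N, r.IsClique S → S.card ≤ m) (F : Finset (Finset V))
    (hF : F.Nonempty) (hFN : ∀ C ∈ F, C ⊆ N ∧ r.IsNClique m C) :
    2 * m ≤ (N.filter fun x => ∀ C ∈ F, x ∈ C).card + (F.biUnion id).card := by
  induction hF using Finset.Nonempty.cons_induction with
  | singleton C =>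
    obtain ⟨h1, h2⟩ := hFN C (by simp)
    have : (N.filter fun x => ∀ D ∈ ({C} : Finset (Finset V)), x ∈ D) = C := by
      ext x; simp; exact fun h => h1 h
    rw [this]
    simp [h2.card_eq]
    omega
  | cons C F hC hF ih =>
    have ih := ih fun D hD => hFN D (Finset.mem_cons_of_mem hD)
    obtain ⟨hCN, hCm⟩ := hFN C (Finset.mem_cons_self _ _)
    obtain ⟨D₀, hD₀⟩ := hF
    set I := N.filter fun x => ∀ D ∈ F, x ∈ D with hI
    set U := F.biUnion id with hU
    have hI' : (N.filter fun x => ∀ D ∈ Finset.cons C F hC, x ∈ D) = I ∩ C := by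
      ext x; simp [hI]; tauto
    have hU' : (Finset.cons C F hC).biUnion id = C ∪ U := by
      ext x; simp [hU]
    have hIU : I ⊆ U := fun x hx =>
      Finset.mem_biUnion.2 ⟨D₀, hD₀, (Finset.mem_filter.1 hx).2 _ hD₀⟩
    have hadj : ∀ a ∈ I, ∀ b ∈ U, a ≠ b → r.Adj a b := by
      intro a ha b hb hab
      obtain ⟨D, hD, hbD⟩ := Finset.mem_biUnion.1 hb
      exact (hFN D (Finset.mem_cons_of_mem hD)).2.isClique ((Finset.mem_filter.1 ha).2 D hD)
        hbD hab
    -- The common part `I` is completely joined to `U`, so adding it to `C ∩ U` yields a clique; its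
    -- maximality bound drives the induction.
    have hle : (I ∪ (C ∩ U)).card ≤ m := by
      refine hmax _ ?_ ?_
      · exact Finset.union_subset (Finset.filter_subset _ _) (Finset.inter_subset_left.trans hCN)
      · intro a ha b hb hab
        rcases Finset.mem_union.1 ha with ha | ha
        · rcases Finset.mem_union.1 hb with hb | hb
          · exact hadj a ha b (hIU hb) hab
          · exact hadj a ha b (Finset.mem_inter.1 hb).2 hab
        · rcases Finset.mem_union.1 hb with hb | hb
          · exact (hadj b hb a (Finset.mem_inter.1 ha).2 hab.symm).symm
          · exact hCm.isClique (Finset.mem_inter.1 ha).1 (Finset.mem_inter.1 hb).1 hab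
    have e1 := Finset.card_union_add_card_inter I (C ∩ U)
    have e2 : I ∩ (C ∩ U) = I ∩ C := by
      ext x
      simp only [Finset.mem_inter]
      exact ⟨fun h => ⟨h.1, h.2.1⟩, fun h => ⟨h.1, h.2, hIU h.1⟩⟩
    have e3 := Finset.card_union_add_card_inter C U
    have e4 := hCm.card_eq
    rw [hI', hU']
    rw [e2] at e1
    omega

/-- A clique `A` that is joined to everything outside a smaller set `L` has a vertex which is
joined to everything, provided that `A` and `L` are suitably saturated. -/
theorem exists_dominating_of_card_lt {G : SimpleGraph V} {c : V → ι} {t : ℕ}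
    (ht : 2 ≤ t) (hfree : (crossGraph G c).CliqueFree t)
    (hsat : ∀ u v, u ≠ v → ¬ G.Adj u v → ∃ Q : Finset V, (crossGraph G c).IsNClique (t - 2) Q ∧
      ∀ q ∈ Q, (crossGraph G c).Adj u q ∧ (crossGraph G c).Adj v q)
    {A L : Finset V} (hA : (crossGraph G c).IsClique A) (hAL : Disjoint A L)
    (hcard : L.card < A.card)
    (hadj : ∀ a ∈ A, ∀ w ∉ L, w ≠ a → (crossGraph G c).Adj a w) :
    ∃ a ∈ A, ∀ w, w ≠ a → (crossGraph G c).Adj a w := by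
  set r := crossGraph G c with hr
  let N : Finset V → Finset V := fun B => L.filter fun y => ∃ a ∈ B, ¬ r.Adj a y
  -- `B` is a minimal violator of Hall's condition for red non-adjacency between `A` and `L`.
  obtain ⟨B, hB, hmin⟩ := (A.powerset.filter fun B => (N B).card < B.card).exists_min_image
    Finset.card ⟨A, by
      simp only [Finset.mem_filter, Finset.mem_powerset, subset_rfl, true_and]
      exact (Finset.card_filter_le _ _).trans_lt hcard⟩
  simp only [Finset.mem_filter, Finset.mem_powerset] at hB hmin
  obtain ⟨hBA, hBcard⟩ := hB
  have hBadj : ∀ a ∈ B, ∀ w ∉ N B, w ≠ a → r.Adj a w := by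
    intro a ha w hw hwa
    by_cases hwL : w ∈ L
    · by_contra h
      exact hw (Finset.mem_filter.2 ⟨hwL, a, ha, h⟩)
    · exact hadj a (hBA ha) w hwL hwa
  by_cases hex : ∃ x ∈ B, ∃ y ∈ N B, ¬ G.Adj x y
  · exfalso
    obtain ⟨x, hx, y, hy, hxy⟩ := hex
    have hyL := (Finset.mem_filter.1 hy).1
    have hne : x ≠ y := fun h => Finset.disjoint_left.1 hAL (hBA hx) (h ▸ hyL)
    obtain ⟨Q, hQ, hQadj⟩ := hsat x y hne hxy
    have hyQ : y ∉ Q := fun h => (hQadj y h).2.ne rfl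
    set C := insert y Q with hC
    have hCclique : r.IsClique C := by
      rw [hC, Finset.coe_insert]
      exact hQ.isClique.insert fun q hq _ => (hQadj q hq).2
    have hCcard : C.card = t - 1 := by
      rw [hC, Finset.card_insert_of_notMem hyQ, hQ.card_eq]
      omega
    have hxC : x ∉ C := by
      rw [hC, Finset.mem_insert]
      rintro (h | h)
      · exact hne h
      · exact (hQadj x h).1.ne rfl
    -- Exchanging `C ∩ N B` for `B \ C` keeps a clique, so `B \ C` is no larger than `C ∩ N B`. Then
    -- `B ∩ C`, which misses `x`, would be a smaller violator.
    have hclique : r.IsClique (((C \ N B) ∪ B : Finset V) : Set V) := by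
      intro a ha b hb hab
      simp only [Finset.coe_union, Finset.coe_sdiff, Set.mem_union, Set.mem_sdiff,
        Finset.mem_coe] at ha hb
      rcases ha with ha | ha
      · rcases hb with hb | hb
        · exact hCclique ha.1 hb.1 hab
        · exact (hBadj b hb a ha.2 hab).symm
      · rcases hb with hb | hb
        · exact hBadj a ha b hb.2 hab.symm
        · exact hA (hBA ha) (hBA hb) hab
    have h1 := hfree.card_lt_of_isClique hclique
    have hBN : Disjoint B (N B) :=
      Finset.disjoint_of_subset_left hBA
        (Finset.disjoint_of_subset_right (Finset.filter_subset _ _) hAL)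
    have h2 : (C \ N B) ∩ B = B ∩ C := by
      ext z
      simp only [Finset.mem_inter, Finset.mem_sdiff]
      exact ⟨fun h => ⟨h.2, h.1.1⟩, fun h => ⟨⟨h.2, Finset.disjoint_left.1 hBN h.1⟩, h.1⟩⟩
    have h3 := Finset.card_union_add_card_inter (C \ N B) B
    rw [h2] at h3
    have h4 := Finset.card_sdiff_add_card_inter C (N B)
    have h5 : N (B ∩ C) ⊆ N B \ C := by
      intro z hz
      obtain ⟨hzL, a, ha, haz⟩ := Finset.mem_filter.1 hz
      obtain ⟨haB, haC⟩ := Finset.mem_inter.1 ha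
      refine Finset.mem_sdiff.2 ⟨Finset.mem_filter.2 ⟨hzL, a, haB, haz⟩, fun hzC => haz ?_⟩
      exact hCclique haC hzC fun h => Finset.disjoint_left.1 hAL (hBA haB) (h ▸ hzL)
    have h6 : (B ∩ C).card ≤ (N (B ∩ C)).card := by
      by_contra! hlt
      have hle := hmin (B ∩ C) ⟨Finset.inter_subset_left.trans hBA, hlt⟩
      have : B ∩ C ⊂ B := by
        refine Finset.ssubset_iff_subset_ne.2 ⟨Finset.inter_subset_left, fun h => hxC ?_⟩
        rw [← h] at hx
        exact (Finset.mem_inter.1 hx).2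
      exact absurd (Finset.card_lt_card this) (by omega)
    have h7 := Finset.card_le_card h5
    have h8 := Finset.card_sdiff_add_card_inter (N B) C
    rw [Finset.inter_comm (N B) C] at h8
    omega
  · push Not at hex
    by_contra! hno
    -- Now `B` and `N B` are fully joined in `G`, so red non-adjacency means a shared fiber. The
    -- vertices of the red clique `B` lie in distinct fibers, so `B` injects into the smaller set `N
    -- B`.
    have hch : ∀ a ∈ B, ∃ y ∈ N B, c y = c a := by
      intro a ha
      obtain ⟨w, hwa, hw⟩ := hno a (hBA ha)
      have hwN : w ∈ N B := by
        by_contra h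
        exact hw (hBadj a ha w h hwa)
      refine ⟨w, hwN, ?_⟩
      by_contra hcne
      exact hw ⟨hex a ha w hwN, Ne.symm hcne⟩
    choose! y hyN hyc using hch
    have hinj : Set.InjOn y B := by
      intro a ha b hb hab
      by_contra hne
      refine (hA (hBA ha) (hBA hb) hne).2 ?_
      rw [← hyc a ha, ← hyc b hb, hab]
    have := Finset.card_le_card_of_injOn y (fun a ha => hyN a ha) hinj
    omega

/-- By Hajnal's lemma the `(t-2)`-cliques in the red neighborhood `N` of `u` have an intersection
`A` larger than the part of `N` they leave uncovered. Each `a ∈ A` is joined to the rest of the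
union and to all non-neighbors of `u`; were it also joined to the whole fiber of `u`,
`exists_dominating_of_card_lt` would give a dominating vertex, which cannot exist. -/
theorem IsCoCritical.exists_not_adj_fiber_of_degree_lt {G : SimpleGraph V} {c : V → ι} {t k : ℕ}
    (hG : IsCoCritical G t k) (ht : 3 ≤ t) (hk : 3 ≤ k) (hc : IsGoodPartition G t k c) {u : V}
    (hdeg : ((crossGraph G c).neighborFinset u).card < 2 * (t - 2))
    (hv : ∃ v, v ≠ u ∧ ¬ G.Adj u v) :
    ∃ a, (∀ z, z ≠ u → ¬ G.Adj u z → (crossGraph G c).Adj a z) ∧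
      ∃ z ∈ fiber c u, ¬ (crossGraph G c).Adj a z := by
  by_contra! hcon
  set r := crossGraph G c with hr
  have hsat : ∀ u v, u ≠ v → ¬ G.Adj u v → ∃ Q : Finset V, r.IsNClique (t - 2) Q ∧
      ∀ q ∈ Q, r.Adj u q ∧ r.Adj v q := fun u v h1 h2 =>
    hG.exists_clique (by omega) hc h1 h2
  set N := r.neighborFinset u with hN
  set F := N.powerset.filter fun Q => r.IsNClique (t - 2) Q with hF
  have hmemF : ∀ z, z ≠ u → ¬ G.Adj u z → ∃ Q ∈ F, ∀ q ∈ Q, r.Adj z q := by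
    intro z hzu hz
    obtain ⟨Q, hQ, hQadj⟩ := hsat u z hzu.symm hz
    refine ⟨Q, Finset.mem_filter.2 ⟨Finset.mem_powerset.2 fun q hq => ?_, hQ⟩,
      fun q hq => (hQadj q hq).2⟩
    rw [hN, SimpleGraph.mem_neighborFinset]
    exact (hQadj q hq).1
  obtain ⟨v, hvu, hv⟩ := hv
  obtain ⟨Q₀, hQ₀, -⟩ := hmemF v hvu hv
  have hFN : ∀ C ∈ F, C ⊆ N ∧ r.IsNClique (t - 2) C := fun C hC =>
    ⟨Finset.mem_powerset.1 (Finset.mem_filter.1 hC).1, (Finset.mem_filter.1 hC).2⟩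
  have hmax : ∀ S ⊆ N, r.IsClique S → S.card ≤ t - 2 := by
    intro S hS hSc
    have huS : u ∉ S := fun h => by simpa [hN] using hS h
    have := hc.cliqueFree.card_lt_of_isClique (S := insert u S) (by
      rw [Finset.coe_insert]
      exact hSc.insert fun q hq _ => by simpa [hN] using hS hq)
    rw [Finset.card_insert_of_notMem huS] at this
    omega
  set A := N.filter fun x => ∀ C ∈ F, x ∈ C with hA
  set U := F.biUnion id with hU
  have hH : 2 * (t - 2) ≤ A.card + U.card := by
    convert r.two_mul_le_card_inter_add_card_union hmax F ⟨Q₀, hQ₀⟩ hFN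
  have hUN : U ⊆ N := Finset.biUnion_subset.2 fun C hC => (hFN C hC).1
  have hcard : (N \ U).card < A.card := by
    have := Finset.card_sdiff_add_card_eq_card hUN
    omega
  have hAQ : ∀ a ∈ A, ∀ C ∈ F, a ∈ C := fun a ha => (Finset.mem_filter.1 ha).2
  have hout : ∀ a ∈ A, ∀ w ∉ N \ U, w ≠ a → r.Adj a w := by
    intro a ha w hw hwa
    have haZ : ∀ z, z ≠ u → ¬ G.Adj u z → r.Adj a z := by
      intro z hzu hz
      obtain ⟨Q, hQ, hQadj⟩ := hmemF z hzu hz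
      exact (hQadj a (hAQ a ha Q hQ)).symm
    by_cases hwc : c w = c u
    · exact hcon a haZ w (mem_fiber.2 hwc)
    · by_cases hGw : G.Adj u w
      · have hwN : w ∈ N := by
          rw [hN, SimpleGraph.mem_neighborFinset]
          exact ⟨hGw, Ne.symm hwc⟩
        have hwU : w ∈ U := by
          by_contra h
          exact hw (Finset.mem_sdiff.2 ⟨hwN, h⟩)
        obtain ⟨C, hC, hwC⟩ := Finset.mem_biUnion.1 hwU
        exact (hFN C hC).2.isClique (hAQ a ha C hC) hwC hwa.symm
      · exact haZ w (fun h => hwc (by rw [h])) hGw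
  obtain ⟨a, ha, hdom⟩ := exists_dominating_of_card_lt (by omega) hc.cliqueFree hsat
    (A := A) (L := N \ U) (fun a ha b hb hab =>
      (hFN Q₀ hQ₀).2.isClique (hAQ a ha _ hQ₀) (hAQ b hb _ hQ₀) hab)
    (Finset.disjoint_left.2 fun a ha h => (Finset.mem_sdiff.1 h).2
      (Finset.mem_biUnion.2 ⟨Q₀, hQ₀, hAQ a ha _ hQ₀⟩)) hcard hout
  obtain ⟨y, hy, hay⟩ := hG.exists_not_crossGraph_adj hk hc a
  exact hay (hdom y hy)

end LowDegree

/-! ### Bounding the exceptional vertices -/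

section Exceptional

open Classical

variable {V ι : Type*} [Fintype V]

/-- A maximum clique works. In a `K_t`-free graph it turns bounds on non-neighborhoods into a bound
on `S`. -/
theorem SimpleGraph.exists_isClique_dominating {V : Type*} (r : SimpleGraph V) (S : Finset V) :
    ∃ C ⊆ S, r.IsClique (C : Set V) ∧ ∀ x ∈ S, ∃ y ∈ C, ¬ r.Adj y x := by
  obtain ⟨C, hC, hmax⟩ := (S.powerset.filter fun C : Finset V => r.IsClique (C : Set V)).exists_max_image
    Finset.card ⟨∅, by simp⟩
  simp only [Finset.mem_filter, Finset.mem_powerset] at hC hmax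
  refine ⟨C, hC.1, hC.2, fun x hx => ?_⟩
  by_contra! h
  have hxC : x ∉ C := fun hxC => (h x hxC).ne rfl
  have := hmax (insert x C) ⟨Finset.insert_subset hx hC.1, by
    rw [Finset.coe_insert]
    exact hC.2.insert fun y hy _ => (h y hy).symm⟩
  rw [Finset.card_insert_of_notMem hxC] at this
  omega

variable {G : SimpleGraph V} {c : V → ι} {t k : ℕ}

/-- Vertices in distinct fibers smaller than `k/2` are red-adjacent, so the fibers of a maximum red
clique among them cover them all. -/
theorem IsCoCritical.card_small_fiber_le (hG : IsCoCritical G t k) (hk : 1 ≤ k)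
    (hc : IsGoodPartition G t k c) :
    (Finset.univ.filter fun v => 2 * (fiber c v).card < k).card ≤ t * k := by
  obtain ⟨C, hCS, hC, hdom⟩ := (crossGraph G c).exists_isClique_dominating
    (Finset.univ.filter fun v => 2 * (fiber c v).card < k)
  have hsub : (Finset.univ.filter fun v => 2 * (fiber c v).card < k) ⊆ C.biUnion (fiber c) := by
    intro x hx
    obtain ⟨y, hy, hyx⟩ := hdom x hx
    refine Finset.mem_biUnion.2 ⟨y, hy, mem_fiber.2 ?_⟩
    by_contra hne
    have hyx' : y ≠ x := fun h => hne (by rw [h])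
    have hG' : ¬ G.Adj y x := fun h => hyx ⟨h, Ne.symm hne⟩
    have h1 := hG.le_card_fiber_add_card_fiber hk hc hyx' hG'
    have h2 := (Finset.mem_filter.1 hx).2
    have h3 := (Finset.mem_filter.1 (hCS hy)).2
    omega
  calc _ ≤ _ := Finset.card_le_card hsub
    _ ≤ C.card * k := Finset.card_biUnion_le_card_mul _ _ _ fun v _ => (hc.card_fiber_lt v).le
    _ ≤ t * k := Nat.mul_le_mul_right _ (hc.cliqueFree.card_lt_of_isClique hC).le

theorem IsCoCritical.exists_degree_ge (hG : IsCoCritical G t k) (ht : 3 ≤ t) (hk : 3 ≤ k)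
    (hc : IsGoodPartition G t k c) (hV : 2 * (t - 2) + k ≤ Fintype.card V) :
    ∃ W : Finset V, W.card ≤ t * (2 * (t - 2) + k) * ((2 * (t - 2) + k) * k) ∧
      ∀ u ∉ W, 2 * (t - 2) ≤ ((crossGraph G c).neighborFinset u).card := by
  set r := crossGraph G c with hr
  set b := 2 * (t - 2) + k with hb
  let M : V → Finset V := fun x => Finset.univ.filter fun y => ¬ r.Adj x y
  set X := Finset.univ.filter fun x => (M x).card ≤ b with hX
  have hXcard : X.card ≤ t * b := by
    obtain ⟨C, hCX, hC, hdom⟩ := r.exists_isClique_dominating X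
    have hsub : X ⊆ C.biUnion M := fun x hx => by
      obtain ⟨y, hy, hyx⟩ := hdom x hx
      exact Finset.mem_biUnion.2 ⟨y, hy, by simp [M, hyx]⟩
    calc _ ≤ _ := Finset.card_le_card hsub
      _ ≤ C.card * b := Finset.card_biUnion_le_card_mul _ _ _ fun v hv =>
        (Finset.mem_filter.1 (hCX hv)).2
      _ ≤ t * b := Nat.mul_le_mul_right _ (hc.cliqueFree.card_lt_of_isClique hC).le
  -- A low-degree `u` yields a vertex `a` with few red non-neighbors, one of them in the fiber of
  -- `u`; hence `u` is reached from `X` in these two steps.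
  refine ⟨X.biUnion fun x => (M x).biUnion (fiber c), ?_, fun u hu => ?_⟩
  · refine (Finset.card_biUnion_le_card_mul _ _ (b * k) fun x hx => ?_).trans
      (Nat.mul_le_mul_right _ hXcard)
    exact (Finset.card_biUnion_le_card_mul _ _ k fun v _ => (hc.card_fiber_lt v).le).trans
      (Nat.mul_le_mul_right _ (Finset.mem_filter.1 hx).2)
  · by_contra! hlt
    have hcover : (r.neighborFinset u ∪ fiber c u).card < b := by
      have := Finset.card_union_le (r.neighborFinset u) (fiber c u)
      have := hc.card_fiber_lt u
      omega
    have hmem : ∀ z, z ∉ r.neighborFinset u ∪ fiber c u → z ≠ u ∧ ¬ G.Adj u z := by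
      intro z hz
      simp only [Finset.mem_union, SimpleGraph.mem_neighborFinset, mem_fiber, not_or] at hz
      exact ⟨fun h => hz.2 (by rw [h]), fun h => hz.1 ⟨h, Ne.symm hz.2⟩⟩
    obtain ⟨v, -, hv⟩ := Finset.exists_mem_notMem_of_card_lt_card
      (s := r.neighborFinset u ∪ fiber c u) (t := Finset.univ) (by
        rw [Finset.card_univ]; omega)
    obtain ⟨a, ha, z, hz, haz⟩ := hG.exists_not_adj_fiber_of_degree_lt ht hk hc hlt ⟨v, hmem v hv⟩
    refine hu (Finset.mem_biUnion.2 ⟨a, ?_, Finset.mem_biUnion.2 ⟨z, Finset.mem_filter.2 ⟨Finset.mem_univ _, haz⟩, ?_⟩⟩)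
    · refine Finset.mem_filter.2 ⟨Finset.mem_univ _, (Finset.card_le_card ?_).trans hcover.le⟩
      intro y hy
      by_contra hy'
      exact (Finset.mem_filter.1 hy).2 (ha y (hmem y hy').1 (hmem y hy').2)
    · rw [mem_fiber] at hz ⊢
      exact hz.symm

end Exceptional

/-! ### Sunflowers and bootstrap percolation -/

section Percolation

open Classical

/-- The sunflower lemma for indexed families of sets of bounded size. -/
theorem exists_sunflower (m p : ℕ) : ∃ n : ℕ, ∀ (α : Type u) (I : Finset ℕ) (f : ℕ → Finset α),
    (∀ i ∈ I, (f i).card ≤ m) → n ≤ I.card →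
      ∃ J ⊆ I, p ≤ J.card ∧ ∃ K, ∀ i ∈ J, ∀ j ∈ J, i ≠ j → f i ∩ f j = K := by
  induction m with
  | zero =>
    refine ⟨p, fun α I f hf hI => ⟨I, subset_rfl, hI, ∅, fun i hi j _ _ => ?_⟩⟩
    rw [Finset.card_eq_zero.1 (Nat.le_zero.1 (hf i hi)), Finset.empty_inter]
  | succ m ih =>
    obtain ⟨n, hn⟩ := ih
    -- If a maximum disjoint subfamily has fewer than `p` members, its union has at most `p * (m +
    -- 1)` points and meets every other set, so some point lies in `n` sets.
    refine ⟨p + p * (m + 1) * n, fun α I f hf hI => ?_⟩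
    obtain ⟨J, hJ, hmax⟩ := (I.powerset.filter fun J =>
      ∀ i ∈ J, ∀ j ∈ J, i ≠ j → f i ∩ f j = ∅).exists_max_image Finset.card ⟨∅, by simp⟩
    simp only [Finset.mem_filter, Finset.mem_powerset] at hJ hmax
    by_cases hpJ : p ≤ J.card
    · exact ⟨J, hJ.1, hpJ, ∅, hJ.2⟩
    set U := J.biUnion f with hU
    have hUcard : U.card ≤ p * (m + 1) :=
      (Finset.card_biUnion_le_card_mul _ _ _ fun i hi => hf i (hJ.1 hi)).trans
        (Nat.mul_le_mul_right _ (by omega))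
    have hcover : I \ J ⊆ U.biUnion fun x => I.filter fun i => x ∈ f i := by
      intro i hi
      obtain ⟨hiI, hiJ⟩ := Finset.mem_sdiff.1 hi
      by_contra hcon
      have hdisj : ∀ j ∈ J, f i ∩ f j = ∅ := by
        intro j hj
        rw [Finset.eq_empty_iff_forall_notMem]
        intro x hx
        obtain ⟨hxi, hxj⟩ := Finset.mem_inter.1 hx
        exact hcon (Finset.mem_biUnion.2 ⟨x, Finset.mem_biUnion.2 ⟨j, hj, hxj⟩,
          Finset.mem_filter.2 ⟨hiI, hxi⟩⟩)
      have := hmax (insert i J) ⟨Finset.insert_subset hiI hJ.1, by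
        intro a ha b hb hab
        rcases Finset.mem_insert.1 ha with ha' | ha'
        · rcases Finset.mem_insert.1 hb with hb' | hb'
          · exact absurd (ha'.trans hb'.symm) hab
          · rw [ha']; exact hdisj b hb'
        · rcases Finset.mem_insert.1 hb with hb' | hb'
          · rw [hb', Finset.inter_comm]; exact hdisj a ha'
          · exact hJ.2 a ha' b hb' hab⟩
      rw [Finset.card_insert_of_notMem hiJ] at this
      omega
    obtain ⟨x, -, hx⟩ : ∃ x ∈ U, n ≤ (I.filter fun i => x ∈ f i).card := by
      by_contra! hlt
      have h1 := (Finset.card_le_card hcover).trans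
        (Finset.card_biUnion_le_card_mul _ _ n fun x hx => (hlt x hx).le)
      have h2 := Nat.mul_le_mul_right n hUcard
      have h3 := Finset.card_sdiff_add_card_eq_card hJ.1
      omega
    obtain ⟨J', hJ', hpJ', K, hK⟩ := hn α (I.filter fun i => x ∈ f i) (fun i => (f i).erase x)
      (fun i hi => by
        obtain ⟨hiI, hxi⟩ := Finset.mem_filter.1 hi
        rw [Finset.card_erase_of_mem hxi]
        have := hf i hiI
        omega) hx
    refine ⟨J', hJ'.trans (Finset.filter_subset _ _), hpJ', insert x K, fun i hi j hj hij => ?_⟩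
    rw [← hK i hi j hj hij]
    have hxi := (Finset.mem_filter.1 (hJ' hi)).2
    have hxj := (Finset.mem_filter.1 (hJ' hj)).2
    ext y
    by_cases hy : y = x
    · subst hy; simp [hxi, hxj]
    · simp [hy]

variable {V ι : Type*} [Fintype V]

/-- Bootstrap percolation: every set `R` is contained in a set `S` that spans at least
`s (|S| - |R|)` edges and outside of which every vertex has less than `s` neighbors in `S`. -/
theorem SimpleGraph.exists_percolation_closed (r : SimpleGraph V) (s : ℕ) (R : Finset V) :
    ∃ S, R ⊆ S ∧ 2 * s * S.card ≤ (∑ v ∈ S, (S.filter (r.Adj v)).card) + 2 * s * R.card ∧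
      ∀ v ∉ S, (S.filter (r.Adj v)).card < s := by
  obtain ⟨S, hS, hmax⟩ := (Finset.univ.filter fun S : Finset V => R ⊆ S ∧
    2 * s * S.card ≤ (∑ v ∈ S, (S.filter (r.Adj v)).card) + 2 * s * R.card).exists_max_image
    Finset.card ⟨R, by simp⟩
  simp only [Finset.mem_filter, Finset.mem_univ, true_and] at hS hmax
  refine ⟨S, hS.1, hS.2, fun v hv => ?_⟩
  by_contra! hle
  have hself : ((insert v S).filter (r.Adj v)).card = (S.filter (r.Adj v)).card := by
    rw [Finset.filter_insert, if_neg (r.loopless.irrefl v)]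
  have hother : ∀ w ∈ S, ((insert v S).filter (r.Adj w)).card =
      (S.filter (r.Adj w)).card + if r.Adj v w then 1 else 0 := by
    intro w _
    rw [Finset.filter_insert]
    by_cases h : r.Adj w v
    · rw [if_pos h, if_pos h.symm, Finset.card_insert_of_notMem (by simp [hv])]
    · rw [if_neg h, if_neg fun h' => h h'.symm, add_zero]
  have hsum : (∑ w ∈ S, if r.Adj v w then 1 else 0) = (S.filter (r.Adj v)).card :=
    (Finset.card_filter _ _).symm
  have := hmax (insert v S) ⟨hS.1.trans (Finset.subset_insert _ _), by
    rw [Finset.sum_insert hv, hself, Finset.sum_congr rfl hother, Finset.sum_add_distrib,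
      hsum, Finset.card_insert_of_notMem hv]
    have := hS.2
    rw [mul_add]
    omega⟩
  rw [Finset.card_insert_of_notMem hv] at this
  omega

/-- Percolation can be started from a set of bounded size so that every vertex outside the closed
set `S` sends many edges, when those not going to `S` are counted by one half. -/
theorem exists_percolation_of_degree_ge (s t k : ℕ) : ∃ n : ℕ, ∀ (V ι : Type u) [Fintype V]
    (G : SimpleGraph V) (c : V → ι) (W : Finset V), IsCoCritical G t k → 2 ≤ t → 1 ≤ k →
    IsGoodPartition G t k c → (∀ u ∉ W, s ≤ ((crossGraph G c).neighborFinset u).card) →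
    ∃ R S : Finset V, R.card ≤ W.card + n ∧
      2 * s * S.card ≤ (∑ v ∈ S, (S.filter ((crossGraph G c).Adj v)).card) + 2 * s * R.card ∧
      ∀ v ∉ S, 2 * s ≤ 2 * (S.filter ((crossGraph G c).Adj v)).card +
        (Sᶜ.filter ((crossGraph G c).Adj v)).card := by
  obtain ⟨m, hm⟩ := exists_sunflower.{u} (2 * s) (s + 1)
  refine ⟨m * (2 * s + k), fun V ι _ G c W hG ht hk hc hW => ?_⟩
  set r := crossGraph G c with hr
  choose S hRS hSsum hSclosed using r.exists_percolation_closed s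
  by_contra! hcon
  have hbad : ∀ R : Finset V, ∃ v, R.card ≤ W.card + m * (2 * s + k) → v ∉ S R ∧
      2 * ((S R).filter (r.Adj v)).card + ((S R)ᶜ.filter (r.Adj v)).card < 2 * s := by
    intro R
    by_cases hR : R.card ≤ W.card + m * (2 * s + k)
    · obtain ⟨v, h1, h2⟩ := hcon R (S R) hR (hSsum R)
      exact ⟨v, fun _ => ⟨h1, h2⟩⟩
    -- For oversized `R` any vertex serves as a default value.
    · obtain ⟨v, -⟩ := hcon W (S W) (by omega) (hSsum W)
      exact ⟨v, fun h => absurd h hR⟩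
  choose v hv using hbad
  -- While a bad vertex exists, its red neighborhood and fiber are added to the seed; bad vertices
  -- have red degree below `2 * s`, so `m` rounds stay within the size budget.
  let R : ℕ → Finset V := fun i =>
    Nat.rec W (fun _ R => R ∪ (r.neighborFinset (v R) ∪ fiber c (v R))) i
  have hRsucc : ∀ i, R (i + 1) = R i ∪ (r.neighborFinset (v (R i)) ∪ fiber c (v (R i))) :=
    fun i => rfl
  have hmono : Monotone R := monotone_nat_of_le_succ fun i => by
    rw [hRsucc]; exact Finset.subset_union_left
  have hdegree : ∀ (T : Finset V) (u : V),
      (T.filter (r.Adj u)).card + (Tᶜ.filter (r.Adj u)).card = (r.neighborFinset u).card := by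
    intro T u
    rw [← Finset.card_union_of_disjoint (Finset.disjoint_filter_filter disjoint_compl_right),
      ← Finset.filter_union, Finset.union_compl]
    congr 1
    ext w; simp
  have hRcard : ∀ i ≤ m, (R i).card ≤ W.card + i * (2 * s + k) := by
    intro i hi
    induction i with
    | zero => simp [R]
    | succ i ih =>
      have hi' := ih (by omega)
      have hle := Nat.mul_le_mul_right (2 * s + k) (show i ≤ m by omega)
      have h1 := (hv (R i) (by omega)).2
      have h2 := hdegree (S (R i)) (v (R i))
      have h3 := hc.card_fiber_lt (v (R i))
      have h4 := Finset.card_union_le (R i) (r.neighborFinset (v (R i)) ∪ fiber c (v (R i)))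
      have h5 := Finset.card_union_le (r.neighborFinset (v (R i))) (fiber c (v (R i)))
      rw [hRsucc, add_mul]
      omega
  have hvR : ∀ i ≤ m, v (R i) ∉ S (R i) ∧ 2 * ((S (R i)).filter (r.Adj (v (R i)))).card +
      ((S (R i))ᶜ.filter (r.Adj (v (R i)))).card < 2 * s := fun i hi =>
    hv (R i) ((hRcard i hi).trans (by gcongr))
  obtain ⟨J, hJ, hJcard, K, hK⟩ := hm V (Finset.range m) (fun i => r.neighborFinset (v (R i)))
    (fun i hi => by
      have h1 := (hvR i (Finset.mem_range.1 hi).le).2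
      have h2 := hdegree (S (R i)) (v (R i))
      omega) (by simp)
  have hJne : J.Nonempty := Finset.card_pos.1 (by omega)
  set j := J.max' hJne with hj
  have hjJ : j ∈ J := J.max'_mem hJne
  have hltj : ∀ i ∈ J.erase j, i < j := fun i hi =>
    lt_of_le_of_ne (J.le_max' i (Finset.mem_of_mem_erase hi)) (Finset.ne_of_mem_erase hi)
  obtain ⟨hvS, hvlt⟩ := hvR j (Finset.mem_range.1 (hJ hjJ)).le
  have hvW : v (R j) ∉ W := fun h => hvS (hRS _ (hmono (Nat.zero_le j) h))
  -- If all of the at least `s` red neighbors were in `S`, counting them twice would already give `2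
  -- * s`.
  obtain ⟨w, hw⟩ : ((S (R j))ᶜ.filter (r.Adj (v (R j)))).Nonempty := by
    rw [← Finset.card_pos]
    have h1 := hW _ hvW
    have h2 := hdegree (S (R j)) (v (R j))
    omega
  obtain ⟨hwS, hwv⟩ := Finset.mem_filter.1 hw
  rw [Finset.mem_compl] at hwS
  have hwR : w ∉ R j := fun h => hwS (hRS _ h)
  -- Since `w` is not adjacent to the earlier `v (R i)`, they share a red `K_{t-2}`. If it lay in
  -- the kernel `K`, it would form a red `K_t` with `w` and `v (R j)`. So `w` has a neighbor in each
  -- of `s` disjoint petals, all inside the closed set: a contradiction.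
  have hex : ∀ i ∈ J.erase j, ∃ q, r.Adj (v (R i)) q ∧ q ∉ K ∧ r.Adj w q := by
    intro i hi
    have hsub : r.neighborFinset (v (R i)) ∪ fiber c (v (R i)) ⊆ R j :=
      (Finset.subset_union_right.trans (hRsucc i).symm.subset).trans (hmono (hltj i hi))
    have hw1 : ¬ r.Adj (v (R i)) w := fun h =>
      hwR (hsub (Finset.mem_union_left _ (by simpa using h)))
    have hw2 : c w ≠ c (v (R i)) := fun h =>
      hwR (hsub (Finset.mem_union_right _ (mem_fiber.2 h)))
    obtain ⟨Q, hQ, hQadj⟩ := hG.exists_clique hk hc (u := v (R i)) (v := w)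
      (fun h => hw2 (by rw [h])) (fun h => hw1 ⟨h, Ne.symm hw2⟩)
    by_contra! hno
    have hQK : ∀ q ∈ Q, r.Adj (v (R j)) q := by
      intro q hq
      have hqK : q ∈ K := by
        by_contra hqK
        exact hno q (hQadj q hq).1 hqK (hQadj q hq).2
      rw [← hK i (Finset.mem_of_mem_erase hi) j hjJ (Finset.ne_of_mem_erase hi)] at hqK
      simpa using (Finset.mem_inter.1 hqK).2
    have hwQ : w ∉ Q := fun h => (hQadj w h).2.ne rfl
    have hvQ : v (R j) ∉ insert w Q := by
      rw [Finset.mem_insert]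
      rintro (h | h)
      · exact hwv.ne h
      · exact (hQK _ h).ne rfl
    refine hc.cliqueFree (insert (v (R j)) (insert w Q)) ⟨?_, ?_⟩
    · rw [Finset.coe_insert, Finset.coe_insert]
      refine (hQ.isClique.insert fun q hq _ => (hQadj q hq).2).insert fun q hq _ => ?_
      rcases hq with rfl | hq
      · exact hwv
      · exact hQK q hq
    · rw [Finset.card_insert_of_notMem hvQ, Finset.card_insert_of_notMem hwQ, hQ.card_eq]
      omega
  have : Nonempty V := ⟨w⟩
  choose! q hqv hqK hqw using hex
  have hinj : Set.InjOn q ((J.erase j : Finset ℕ) : Set ℕ) := by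
    intro a ha b hb hab
    by_contra hne
    apply hqK a ha
    rw [← hK a (Finset.mem_of_mem_erase ha) b (Finset.mem_of_mem_erase hb) hne, Finset.mem_inter]
    refine ⟨by simpa using hqv a ha, ?_⟩
    rw [hab]
    simpa using hqv b hb
  have hle := Finset.card_le_card_of_injOn (t := (S (R j)).filter (r.Adj w)) q (fun i hi => by
    refine Finset.mem_filter.2 ⟨hRS _ (hmono (hltj i hi) ?_), hqw i hi⟩
    change _ ∈ R (i + 1)
    rw [hRsucc]
    refine Finset.mem_union_right _ (Finset.mem_union_left _ ?_)
    simpa using hqv i hi) hinj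
  have hlt := hSclosed (R j) w hwS
  rw [Finset.card_erase_of_mem hjJ] at hle
  omega

end Percolation

/-! ### Degree sums -/

section Counting

open Classical

variable {V ι : Type*} [Fintype V]

/-- An edge between `S` and its complement counts once at each end in the degree sum; crediting both
to the outer end explains the factor two in `hout`. -/
theorem SimpleGraph.two_mul_card_le_sum_degree (r : SimpleGraph V) {s : ℕ} {R S : Finset V}
    (hS : 2 * s * S.card ≤ (∑ v ∈ S, (S.filter (r.Adj v)).card) + 2 * s * R.card)
    (hout : ∀ v ∉ S, 2 * s ≤ 2 * (S.filter (r.Adj v)).card + (Sᶜ.filter (r.Adj v)).card) :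
    2 * s * Fintype.card V ≤ (∑ v, (r.neighborFinset v).card) + 2 * s * R.card := by
  have hdegree : ∀ u, (r.neighborFinset u).card =
      (S.filter (r.Adj u)).card + (Sᶜ.filter (r.Adj u)).card := by
    intro u
    rw [← Finset.card_union_of_disjoint (Finset.disjoint_filter_filter disjoint_compl_right),
      ← Finset.filter_union, Finset.union_compl]
    congr 1
    ext w; simp
  have hcross : ∑ v ∈ S, (Sᶜ.filter (r.Adj v)).card = ∑ v ∈ Sᶜ, (S.filter (r.Adj v)).card := by
    simp only [Finset.card_filter]
    rw [Finset.sum_comm]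
    simp only [r.adj_comm]
  have h1 : Sᶜ.card * (2 * s) ≤
      ∑ v ∈ Sᶜ, (2 * (S.filter (r.Adj v)).card + (Sᶜ.filter (r.Adj v)).card) := by
    rw [← smul_eq_mul]
    exact Finset.card_nsmul_le_sum _ _ _ fun v hv => hout v (Finset.mem_compl.1 hv)
  rw [Finset.sum_add_distrib, ← Finset.mul_sum] at h1
  rw [← Finset.sum_add_sum_compl S]
  simp only [hdegree, Finset.sum_add_distrib]
  rw [hcross, ← Finset.card_add_card_compl S, mul_add, mul_comm (2 * s) Sᶜ.card]
  omega

variable {G : SimpleGraph V} {c : V → ι} {t k : ℕ}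

theorem IsCoCritical.degree_crossGraph_add_card_fiber_le (hG : IsCoCritical G t k) (hk : 1 ≤ k)
    (hc : IsGoodPartition G t k c) (v : V) :
    ((crossGraph G c).neighborFinset v).card + ((fiber c v).card - 1) ≤ G.degree v := by
  rw [← Finset.card_erase_of_mem (mem_fiber.2 rfl : v ∈ fiber c v),
    ← Finset.card_union_of_disjoint, ← SimpleGraph.card_neighborFinset_eq_degree]
  · refine Finset.card_le_card (Finset.union_subset ?_ ?_) <;> intro w hw
    · rw [SimpleGraph.mem_neighborFinset] at hw ⊢
      exact hw.1
    · rw [Finset.mem_erase, mem_fiber] at hw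
      rw [SimpleGraph.mem_neighborFinset]
      exact hG.adj_of_fiber hk hc hw.1.symm hw.2.symm
  · refine Finset.disjoint_left.2 fun w hw hw' => ?_
    rw [SimpleGraph.mem_neighborFinset] at hw
    rw [Finset.mem_erase, mem_fiber] at hw'
    exact hw.2 hw'.2.symm

theorem IsCoCritical.card_le_sum_card_fiber (hG : IsCoCritical G t k) (hk : 1 ≤ k)
    (hc : IsGoodPartition G t k c) :
    (k - 1) / 2 * Fintype.card V ≤ (∑ v, ((fiber c v).card - 1)) + (k - 1) / 2 * (t * k) := by
  have h1 := hG.card_small_fiber_le hk hc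
  set T := Finset.univ.filter fun v => 2 * (fiber c v).card < k with hT
  have h2 : Tᶜ.card * ((k - 1) / 2) ≤ ∑ v ∈ Tᶜ, ((fiber c v).card - 1) := by
    rw [← smul_eq_mul]
    refine Finset.card_nsmul_le_sum _ _ _ fun v hv => ?_
    have : ¬ 2 * (fiber c v).card < k := by simpa [hT] using hv
    -- A fiber with at least `k/2` vertices leaves at least `⌈k/2⌉ - 1 = (k - 1) / 2` (rounded down)
    -- others.
    omega
  have h3 : ∑ v ∈ Tᶜ, ((fiber c v).card - 1) ≤ ∑ v, ((fiber c v).card - 1) :=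
    Finset.sum_le_sum_of_subset (Finset.subset_univ _)
  have h4 := Nat.mul_le_mul_left ((k - 1) / 2) h1
  rw [← Finset.card_add_card_compl T, mul_add, mul_comm _ Tᶜ.card]
  omega

end Counting

/-! ### The edge bound -/

open Classical in
/-- The edge bound for co-critical graphs, with an additive constant depending on `t` and `k`. -/
theorem exists_card_edgeFinset_ge (t k : ℕ) (ht : 3 ≤ t) (hk : 3 ≤ k) :
    ∃ ℓ : ℕ, ∀ (V : Type u) [Fintype V] (G : SimpleGraph V),
      2 * (t - 2) + k ≤ Fintype.card V → IsCoCritical G t k →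
        (4 * (t - 2) + (k - 1) / 2) * Fintype.card V ≤ 2 * G.edgeFinset.card + ℓ := by
  obtain ⟨m, hm⟩ := exists_percolation_of_degree_ge.{u} (2 * (t - 2)) t k
  refine ⟨2 * (2 * (t - 2)) * (t * (2 * (t - 2) + k) * ((2 * (t - 2) + k) * k) + m) +
    (k - 1) / 2 * (t * k), fun V _ G hV hG => ?_⟩
  obtain ⟨ι, c, hc⟩ := exists_isGoodPartition (by omega) hG.not_arrows
  obtain ⟨W, hWcard, hW⟩ := hG.exists_degree_ge ht hk hc hV
  obtain ⟨R, S, hR, hS, hout⟩ := hm V ι G c W hG (by omega) (by omega) hc hW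
  have h1 := (crossGraph G c).two_mul_card_le_sum_degree hS hout
  have h2 := hG.card_le_sum_card_fiber (by omega) hc
  have h3 : (∑ v, ((crossGraph G c).neighborFinset v).card) + ∑ v, ((fiber c v).card - 1) ≤
      2 * G.edgeFinset.card := by
    rw [← Finset.sum_add_distrib, ← G.sum_degrees_eq_twice_card_edges]
    exact Finset.sum_le_sum fun v _ => hG.degree_crossGraph_add_card_fiber_le (by omega) hc v
  have h4 := Nat.mul_le_mul_left (2 * (2 * (t - 2))) (hR.trans (Nat.add_le_add_right hWcard m))
  have h5 : 4 * (t - 2) = 2 * (2 * (t - 2)) := by ring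
  rw [add_mul, h5]
  omega

theorem mainTheorem1 (t k : ℕ) (ht : 4 ≤ t) (hk : max 6 t ≤ k) :
    ∃ ℓ : ℝ, ∀ n : ℕ, (t - 1) * (k - 1) + 1 ≤ n →
      ∀ G : SimpleGraph (Fin n), IsCoCritical G t k →
        ((4 * (t : ℝ) - 9) / 2 + 1 / 2 * ((⌈(k : ℝ) / 2⌉ : ℤ) : ℝ)) * (n : ℝ) - ℓ
          ≤ (G.edgeSet.ncard : ℝ) := by
  classical
  have hk6 : 6 ≤ k := (le_max_left 6 t).trans hk
  obtain ⟨ℓ, hℓ⟩ := exists_card_edgeFinset_ge.{0} t k (by omega) (by omega)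
  refine ⟨ℓ / 2, fun n hn G hG => ?_⟩
  -- The lower bound on `n` serves to ensure that a vertex of low red degree has a non-neighbor.
  have hcard : 2 * (t - 2) + k ≤ n := by
    obtain ⟨a, rfl⟩ := Nat.exists_eq_add_of_le ht
    obtain ⟨b, rfl⟩ := Nat.exists_eq_add_of_le hk6
    have e1 : 4 + a - 1 = a + 3 := by omega
    have e2 : 6 + b - 1 = b + 5 := by omega
    have e3 : 4 + a - 2 = a + 2 := by omega
    rw [e1, e2] at hn
    rw [e3]
    nlinarith [Nat.zero_le (a * b)]
  have h := hℓ (Fin n) G (by simpa using hcard) hG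
  rw [Fintype.card_fin] at h
  have hE : G.edgeSet.ncard = G.edgeFinset.card := by
    rw [← SimpleGraph.coe_edgeFinset, Set.ncard_coe_finset]
  have hceil : ((⌈(k : ℝ) / 2⌉ : ℤ) : ℝ) ≤ ((k - 1) / 2 : ℕ) + 1 := by
    have h1 : (k : ℝ) ≤ 2 * (((k - 1) / 2 + 1 : ℕ) : ℝ) := by
      exact_mod_cast (show k ≤ 2 * ((k - 1) / 2 + 1) by omega)
    have h2 : ⌈(k : ℝ) / 2⌉ ≤ (((k - 1) / 2 + 1 : ℕ) : ℤ) := by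
      rw [Int.ceil_le, Int.cast_natCast]
      linarith
    rw [← Nat.cast_succ, ← Int.cast_natCast]
    exact Int.cast_le.2 h2
  have h' : (4 * ((t : ℝ) - 2) + ((k - 1) / 2 : ℕ)) * n ≤ 2 * (G.edgeFinset.card : ℝ) + ℓ := by
    have h0 : (((4 * (t - 2) + (k - 1) / 2) * n : ℕ) : ℝ) ≤
        ((2 * G.edgeFinset.card + ℓ : ℕ) : ℝ) := Nat.cast_le.2 h
    rw [Nat.cast_mul, Nat.cast_add, Nat.cast_add, Nat.cast_mul, Nat.cast_mul,
      Nat.cast_sub (by omega : 2 ≤ t)] at h0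
    exact_mod_cast h0
  rw [hE]
  have h3 := mul_le_mul_of_nonneg_right hceil (Nat.cast_nonneg (α := ℝ) n)
  linarith
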